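/- Let $k\in\mathbb{N}=\{0,1,2,\dots\}$, let $R>0$, let $S^k=S^k(R)\subset\mathbb{R}^{k+1}$ be the sphere of radius $R$ centered at the origin, with surface measure $dS$ (for $k=0$, counting measure on the two points $\pm R$), and fix $x\in\mathbb{R}^{k+1}$ with $|x|\neq R$. For $y\in S^k$ let $$\omega=\omega(x,y)=\frac{|x-y^*|}{|x-y|}=\left|\frac{|x|^2-|y|^2}{|x-y|^2}\right|,$$ where $y^*$ is the second point of intersection of the line through $x$ and $y$ with $S^k$ ($y^*=y$ if this line is tangent to $S^k$). For $\alpha\in\mathbb{C}$ put $F(\alpha)=\int_{S^k}\omega^{\alpha}\,dS_y$. Then all the integrals below converge absolutely, and the following hold. (1) For every $b\in\mathbb{R}$ and $\alpha=k/2+ib$, $$\int_{S^k}\omega^{\alpha}\,dS_y=\int_{S^k}\omega^{k/2}\cos(b\ln\omega)\,dS_y .$$ (2) For every $b\in\mathbb{R}$ and every $m=0,1,2,\dots$, $$\int_{S^k}\omega^{k/2}(\ln\omega)^{2m+1}\cos(b\ln\omega)\,dS_y=0,\qquad \int_{S^k}\omega^{k/2}(\ln\omega)^{2m}\sin(b\ln\omega)\,dS_y=0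 .$$ (3) $F$ is an entire function, and for every $\alpha\in\mathbb{C}$ $$F(\alpha)=\sum_{m=0}^{\infty}\frac{(\alpha-k/2)^{2m}}{(2m)!}\int_{S^k}\omega^{k/2}(\ln\omega)^{2m}\,dS_y ,$$ which is the Taylor expansion of $F$ at $k/2$: for every $m=0,1,2,\dots$, $F^{(2m)}(k/2)=\int_{S^k}\omega^{k/2}(\ln\omega)^{2m}\,dS_y$ and $F^{(2m+1)}(k/2)=0$. -/

import Mathlib

open MeasureTheory

/-- For `a ≠ b`, the second common point of the line through `a` and `b` with the sphere of radius
`‖a‖` centred at the origin; it is `a` itself when this line is tangent to that sphere at `a`.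
With `a = y`, `b = x` this is `y^*`; with `a = x`, `b = y` this is `x^*`. -/
noncomputable def starPoint {k : ℕ} (a b : EuclideanSpace ℝ (Fin (k + 1))) :
    EuclideanSpace ℝ (Fin (k + 1)) :=
  (EuclideanGeometry.Sphere.mk (0 : EuclideanSpace ℝ (Fin (k + 1))) ‖a‖).secondInter a (b - a)

/-- The spherical ratio `ω(x, y) = |x - y^*| / |x - y|` of two distinct points. -/
noncomputable def sphericalRatio {k : ℕ} (x y : EuclideanSpace ℝ (Fin (k + 1))) : ℝ :=
  ‖x - starPoint y x‖ / ‖x - y‖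

/-- The surface measure `dS` on the sphere of radius `R` centred at the origin of `ℝ^(k+1)`, as a
measure on `ℝ^(k+1)`: Mathlib's surface measure of the unit sphere, pushed forward by `y ↦ R y` and
multiplied by `R ^ k`. -/
noncomputable def sphereSurface (k : ℕ) (R : ℝ) : Measure (EuclideanSpace ℝ (Fin (k + 1))) :=
  ENNReal.ofReal (R ^ k) •
    Measure.map
      (fun y : Metric.sphere (0 : EuclideanSpace ℝ (Fin (k + 1))) 1 =>
        R • (y : EuclideanSpace ℝ (Fin (k + 1))))
      (volume : Measure (EuclideanSpace ℝ (Fin (k + 1)))).toSphere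

/-- `F(α) = ∫ ω(x, y) ^ α dS_y` over the sphere of radius `R`. -/
noncomputable def ratioIntegral {k : ℕ} (R : ℝ) (x : EuclideanSpace ℝ (Fin (k + 1))) (α : ℂ) : ℂ :=
  ∫ y, (sphericalRatio x y : ℂ) ^ α ∂(sphereSurface k R)

theorem sphericalRatio_eq_abs {k : ℕ} {x y : EuclideanSpace ℝ (Fin (k + 1))} (h : x ≠ y) :
    sphericalRatio x y = |(‖x‖ ^ 2 - ‖y‖ ^ 2) / ‖x - y‖ ^ 2| := by
  have hv : ‖x - y‖ ≠ 0 := norm_ne_zero_iff.mpr (sub_ne_zero.mpr h)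
  have h1 : x - starPoint y x
      = (1 - (-2 * inner ℝ (x - y) y / inner ℝ (x - y) (x - y))) • (x - y) := by
    simp only [starPoint, EuclideanGeometry.Sphere.secondInter, vsub_eq_sub, vadd_eq_add, sub_zero,
      sub_smul, one_smul]
    abel
  have h2 : ‖x‖ ^ 2 = ‖x - y‖ ^ 2 + 2 * inner ℝ (x - y) y + ‖y‖ ^ 2 := by
    rw [← norm_add_sq_real, sub_add_cancel]
  rw [sphericalRatio, h1, norm_smul, Real.norm_eq_abs, mul_div_assoc, div_self hv, mul_one,
    real_inner_self_eq_norm_sq, h2]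
  congr 1
  field_simp
  ring

theorem sphericalRatio_eq_div {k : ℕ} {x y : EuclideanSpace ℝ (Fin (k + 1))} (h : x ≠ y) :
    sphericalRatio x y = ‖starPoint x y - y‖ / ‖x - y‖ := by
  have h1 := sphericalRatio_eq_abs h.symm
  rw [sphericalRatio, norm_sub_rev y (starPoint x y), norm_sub_rev y x] at h1
  rw [h1, sphericalRatio_eq_abs h, abs_div, abs_div, abs_sub_comm]

/-! The map y ↦ y^* is an involution of the sphere which replaces ω by 1/ω and has Jacobian ω^k.
Hence for odd h the substitution turns ∫ ω^{k/2} h(ln ω) into ∫ ω^k ω^{-k/2} h(-ln ω), its own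
negative, so it vanishes. Odd powers of ln ω times cosines, and even powers times sines, are the
cases needed.

To stay in flat space, the involution is extended to a norm-preserving map of the punctured unit
ball (`chordInvolution`). Its derivative is a reflection after a scaling, so its determinant is
explicit (`abs_det_chordInvolutionDeriv`), and radial projection carries the result to the sphere
(`sphereSurface_eq_map_restrict_ball`).

Since |x| ≠ R, ln ω is bounded, so F is the complex moment generating function of ln ω for a finite
measure. It is entire, its derivatives at k/2 are weighted moments of ln ω, and the odd ones vanish.
-/

/-! ### The chord involution and its derivative -/

section ChordInvolution

variable {E : Type*} [NormedAddCommGroup E] [InnerProductSpace ℝ E]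

/-- The signed power ratio `‖y‖² (‖x‖² - 1) / ‖y - ‖y‖ x‖²`; on the unit sphere its absolute value
is the spherical ratio of `x` and `y`. -/
noncomputable def signedRatio (x y : E) : ℝ :=
  ‖y‖ ^ 2 * (‖x‖ ^ 2 - 1) / ‖y - ‖y‖ • x‖ ^ 2

/-- The extension, homogeneous of degree one, of the map that sends a point `y` of the unit sphere
to the second common point of the line through `x` and `y` with the sphere. -/
noncomputable def chordInvolution (x y : E) : E :=
  ‖y‖ • x + signedRatio x y • (y - ‖y‖ • x)

theorem sub_norm_smul_ne_zero {x y : E} (hx : ‖x‖ ≠ 1) (hy : y ≠ 0) : y - ‖y‖ • x ≠ 0 := by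
  intro h
  have h1 : ‖y‖ = ‖y‖ * ‖x‖ := by
    conv_lhs => rw [sub_eq_zero.mp h, norm_smul, norm_norm]
  have h2 : ‖y‖ ≠ 0 := norm_ne_zero_iff.mpr hy
  exact hx (mul_left_cancel₀ h2 (by rw [mul_one]; exact h1.symm))

theorem norm_sub_norm_smul_sq (x y : E) :
    ‖y - ‖y‖ • x‖ ^ 2 = ‖y‖ ^ 2 - 2 * ‖y‖ * inner ℝ x y + ‖y‖ ^ 2 * ‖x‖ ^ 2 := by
  rw [norm_sub_sq_real, norm_smul, norm_norm, inner_smul_right, real_inner_comm]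
  ring

theorem signedRatio_ne_zero {x y : E} (hx : ‖x‖ ≠ 1) (hy : y ≠ 0) : signedRatio x y ≠ 0 := by
  have h1 : ‖y‖ ≠ 0 := norm_ne_zero_iff.mpr hy
  have h2 : ‖y - ‖y‖ • x‖ ≠ 0 := norm_ne_zero_iff.mpr (sub_norm_smul_ne_zero hx hy)
  have h3 : ‖x‖ ^ 2 - 1 ≠ 0 := by
    intro h
    exact hx ((sq_eq_sq₀ (norm_nonneg x) zero_le_one).mp (by linarith))
  unfold signedRatio
  positivity

/-- On the line ‖y‖x + t(y - ‖y‖x), the condition of having norm ‖y‖ is quadratic in t. One root is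
t = 1, and the product of the roots is `signedRatio x y`, which is therefore the other root. -/
theorem norm_chordInvolution {x y : E} (hx : ‖x‖ ≠ 1) (hy : y ≠ 0) :
    ‖chordInvolution x y‖ = ‖y‖ := by
  have h2 : ‖y - ‖y‖ • x‖ ≠ 0 := norm_ne_zero_iff.mpr (sub_norm_smul_ne_zero hx hy)
  have h4 := norm_sub_norm_smul_sq x y
  rw [← sq_eq_sq₀ (norm_nonneg _) (norm_nonneg _), chordInvolution, norm_add_sq_real,
    norm_smul, norm_smul, inner_smul_left, inner_smul_right, inner_sub_right, inner_smul_right,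
    real_inner_self_eq_norm_sq, mul_pow, mul_pow, Real.norm_eq_abs, sq_abs]
  simp only [Real.norm_eq_abs, sq_abs, conj_trivial, signedRatio]
  generalize ‖y - ‖y‖ • x‖ = N at *
  field_simp
  rw [h4]
  ring

theorem chordInvolution_ne_zero {x y : E} (hx : ‖x‖ ≠ 1) (hy : y ≠ 0) :
    chordInvolution x y ≠ 0 := by
  rw [← norm_ne_zero_iff, norm_chordInvolution hx hy]
  exact norm_ne_zero_iff.mpr hy

/-- The involution multiplies the vector from ‖y‖x by the ratio λ, so the denominator of the ratio
gains λ² while its numerator is unchanged. -/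
theorem signedRatio_chordInvolution {x y : E} (hx : ‖x‖ ≠ 1) (hy : y ≠ 0) :
    signedRatio x (chordInvolution x y) = (signedRatio x y)⁻¹ := by
  have h0 := signedRatio_ne_zero hx hy
  have h2 : ‖y - ‖y‖ • x‖ ≠ 0 := norm_ne_zero_iff.mpr (sub_norm_smul_ne_zero hx hy)
  rw [signedRatio, norm_chordInvolution hx hy, chordInvolution, add_sub_cancel_left, norm_smul,
    mul_pow, Real.norm_eq_abs, sq_abs]
  have h5 : signedRatio x y * ‖y - ‖y‖ • x‖ ^ 2 = ‖y‖ ^ 2 * (‖x‖ ^ 2 - 1) := by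
    rw [signedRatio]; field_simp
  rw [← h5]
  field_simp

theorem chordInvolution_chordInvolution {x y : E} (hx : ‖x‖ ≠ 1) (hy : y ≠ 0) :
    chordInvolution x (chordInvolution x y) = y := by
  have h0 := signedRatio_ne_zero hx hy
  rw [chordInvolution, norm_chordInvolution hx hy, signedRatio_chordInvolution hx hy,
    chordInvolution, add_sub_cancel_left, smul_smul, inv_mul_cancel₀ h0, one_smul]
  abel

/-- The derivative of `chordInvolution x` at `y`: a reflection composed with the map that scales
the orthogonal complement of `y` by `signedRatio x y` and fixes `y`. -/
noncomputable def chordInvolutionDeriv (x y : E) : E →ₗ[ℝ] E :=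
  LinearMap.transvection
      ((-2 / ‖y - ‖y‖ • x‖ ^ 2) • (innerₛₗ ℝ (y - ‖y‖ • x))) (y - ‖y‖ • x) ∘ₗ
    (signedRatio x y • LinearMap.transvection
      (((1 - signedRatio x y) / (signedRatio x y * ‖y‖ ^ 2)) • (innerₛₗ ℝ y)) y)

/-- A transvection v ↦ v + f(v)w has determinant 1 + f(w). The reflection gives -1, and the scaled
factor gives λ^{k+1} · (1/λ) with λ = `signedRatio x y`. -/
theorem abs_det_chordInvolutionDeriv [FiniteDimensional ℝ E] {k : ℕ}
    (hk : Module.finrank ℝ E = k + 1) {x y : E} (hx : ‖x‖ ≠ 1) (hy : y ≠ 0) :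
    |LinearMap.det (chordInvolutionDeriv x y)| = |signedRatio x y| ^ k := by
  have h0 := signedRatio_ne_zero hx hy
  have h1 : ‖y‖ ≠ 0 := norm_ne_zero_iff.mpr hy
  have h2 : ‖y - ‖y‖ • x‖ ≠ 0 := norm_ne_zero_iff.mpr (sub_norm_smul_ne_zero hx hy)
  rw [chordInvolutionDeriv, LinearMap.det_comp, LinearMap.det_smul, LinearMap.transvection.det,
    LinearMap.transvection.det, hk]
  simp only [LinearMap.smul_apply, innerₛₗ_apply_apply, real_inner_self_eq_norm_sq, smul_eq_mul]
  rw [div_mul_cancel₀ _ (pow_ne_zero 2 h2), ← abs_pow, ← abs_neg]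
  congr 1
  field_simp
  ring

theorem hasFDerivAt_chordInvolution [FiniteDimensional ℝ E] {x y : E} (hx : ‖x‖ ≠ 1)
    (hy : y ≠ 0) :
    HasFDerivAt (chordInvolution x) (chordInvolutionDeriv x y).toContinuousLinearMap y := by
  have h0 := signedRatio_ne_zero hx hy
  have h1 : ‖y‖ ≠ 0 := norm_ne_zero_iff.mpr hy
  have h2 : ‖y - ‖y‖ • x‖ ≠ 0 := norm_ne_zero_iff.mpr (sub_norm_smul_ne_zero hx hy)
  have hn : HasFDerivAt (fun z : E => ‖z‖) (‖y‖⁻¹ • innerSL ℝ y) y := by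
    have h := (hasStrictFDerivAt_norm_sq y).hasFDerivAt.sqrt (pow_ne_zero 2 h1)
    simp only [Real.sqrt_sq (norm_nonneg _)] at h
    refine h.congr_fderiv ?_
    ext v
    simp
    field_simp
  have hu : HasFDerivAt (fun z : E => z - ‖z‖ • x) _ y := (hasFDerivAt_id y).sub (hn.smul_const x)
  have hi := (hasDerivAt_inv (pow_ne_zero 2 h2)).comp_hasFDerivAt y hu.norm_sq
  have h := (hn.smul_const x).add ((((hn.pow 2).mul_const (‖x‖ ^ 2 - 1)).mul hi).smul hu)
  refine (h.congr_of_eventuallyEq (Filter.Eventually.of_forall fun z => ?_)).congr_fderiv ?_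
  · simp [chordInvolution, signedRatio, div_eq_mul_inv]
  · ext v
    have h4 := norm_sub_norm_smul_sq x y
    -- Expressing ‖x‖² and ⟨x, y⟩ through ‖y‖, ‖y - ‖y‖x‖ and the ratio reduces the equality to
    -- rational identities between coefficients.
    have h5 : ‖x‖ ^ 2 = 1 + signedRatio x y * ‖y - ‖y‖ • x‖ ^ 2 / ‖y‖ ^ 2 := by
      rw [signedRatio]; field_simp; ring
    have h6 : inner ℝ x y
        = (2 * ‖y‖ ^ 2 + (signedRatio x y - 1) * ‖y - ‖y‖ • x‖ ^ 2) / (2 * ‖y‖) := by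
      have h7 : signedRatio x y * ‖y - ‖y‖ • x‖ ^ 2 = ‖y‖ ^ 2 * (‖x‖ ^ 2 - 1) := by
        rw [signedRatio]; field_simp
      field_simp
      linarith
    simp only [chordInvolutionDeriv, LinearMap.transvection.apply, inner_sub_left,
      inner_smul_left, inner_sub_right, inner_smul_right, map_smul, map_add,
      LinearMap.coe_toContinuousLinearMap', LinearMap.comp_apply, LinearMap.smul_apply,
      innerₛₗ_apply_apply, innerSL_apply_apply, _root_.add_apply,
      _root_.smul_apply, ContinuousLinearMap.smulRight_apply,
      _root_.sub_apply, ContinuousLinearMap.comp_apply, ContinuousLinearMap.id_apply,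
      Pi.mul_apply, Function.comp_apply, smul_eq_mul, nsmul_eq_mul, real_inner_self_eq_norm_sq,
      conj_trivial]
    rw [real_inner_comm x y, h5, h6]
    generalize ‖y - ‖y‖ • x‖ = N at *
    generalize signedRatio x y = l at *
    match_scalars <;> field_simp <;> ring

end ChordInvolution

/-! ### Change of variables in the punctured ball -/

section ChordChangeOfVariables

variable {E : Type*} [NormedAddCommGroup E] [InnerProductSpace ℝ E] [FiniteDimensional ℝ E]
  [MeasurableSpace E] [BorelSpace E]

/-- The exponent k/2 is the one balanced by the Jacobian: λ^k λ^{-k/2} = λ^{k/2} for λ =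
|`signedRatio x y`|, while log λ changes sign. The integral equals its negative. -/
theorem setIntegral_abs_signedRatio_rpow_mul_odd_eq_zero {k : ℕ} (hk : Module.finrank ℝ E = k + 1)
    {x : E} (hx : ‖x‖ ≠ 1) {h : ℝ → ℝ} (hodd : ∀ t, h (-t) = -h t) :
    ∫ y in Metric.ball (0 : E) 1 \ {0},
      |signedRatio x y| ^ ((k : ℝ) / 2) * h (Real.log |signedRatio x y|) = 0 := by
  set D : Set E := Metric.ball (0 : E) 1 \ {0} with hD
  have hDm : MeasurableSet D := Metric.isOpen_ball.measurableSet.diff (measurableSet_singleton 0)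
  have hmaps : ∀ y ∈ D, chordInvolution x y ∈ D := by
    rintro y ⟨h1, h2⟩
    refine ⟨?_, chordInvolution_ne_zero hx h2⟩
    rw [mem_ball_zero_iff] at h1 ⊢
    rwa [norm_chordInvolution hx h2]
  have hinj : Set.InjOn (chordInvolution x) D := by
    intro y hy z hz hyz
    rw [← chordInvolution_chordInvolution hx hy.2, hyz, chordInvolution_chordInvolution hx hz.2]
  have himage : chordInvolution x '' D = D := by
    refine Set.Subset.antisymm (Set.image_subset_iff.mpr hmaps) fun y hy => ?_
    exact ⟨_, hmaps y hy, chordInvolution_chordInvolution hx hy.2⟩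
  have key := integral_image_eq_integral_abs_det_fderiv_smul volume hDm
    (fun y hy => (hasFDerivAt_chordInvolution hx hy.2).hasFDerivWithinAt) hinj
    (fun y => |signedRatio x y| ^ ((k : ℝ) / 2) * h (Real.log |signedRatio x y|))
  rw [himage] at key
  have hneg : ∀ y ∈ D, |(chordInvolutionDeriv x y).toContinuousLinearMap.det| •
        (|signedRatio x (chordInvolution x y)| ^ ((k : ℝ) / 2)
          * h (Real.log |signedRatio x (chordInvolution x y)|))
      = -(|signedRatio x y| ^ ((k : ℝ) / 2) * h (Real.log |signedRatio x y|)) := by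
    intro y hy
    have hpos : 0 < |signedRatio x y| := abs_pos.mpr (signedRatio_ne_zero hx hy.2)
    rw [ContinuousLinearMap.det, LinearMap.coe_toContinuousLinearMap,
      abs_det_chordInvolutionDeriv hk hx hy.2, signedRatio_chordInvolution hx hy.2, abs_inv,
      Real.log_inv, hodd, Real.inv_rpow hpos.le, ← Real.rpow_neg hpos.le, smul_eq_mul, ← mul_assoc,
      ← Real.rpow_natCast, ← Real.rpow_add hpos, mul_neg]
    congr 3
    ring
  rw [setIntegral_congr_fun hDm hneg, integral_neg] at key
  linarith

end ChordChangeOfVariables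

/-! ### Transfer to the sphere and bounds for ω -/

section SphereSurface

variable {k : ℕ}

/-- The surface measure of a set on the unit sphere is k + 1 times the volume of the cone over it,
and that cone is a preimage under radial projection. -/
theorem sphereSurface_eq_map_restrict_ball (k : ℕ) (R : ℝ) :
    sphereSurface k R = ENNReal.ofReal (R ^ k) • ((k + 1 : ℕ) : ENNReal) •
      Measure.map (fun y : EuclideanSpace ℝ (Fin (k + 1)) => (R / ‖y‖) • y)
        (volume.restrict (Metric.ball 0 1 \ {0})) := by
  have hm : Measurable fun y : EuclideanSpace ℝ (Fin (k + 1)) => (R / ‖y‖) • y := by fun_prop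
  have hm' : Measurable fun y : Metric.sphere (0 : EuclideanSpace ℝ (Fin (k + 1))) 1 =>
      R • (y : EuclideanSpace ℝ (Fin (k + 1))) := by fun_prop
  rw [sphereSurface]
  congr 1
  ext s hs
  rw [Measure.map_apply hm' hs, Measure.toSphere_apply' _ (hm' hs), Measure.smul_apply,
    Measure.map_apply hm hs, Measure.restrict_apply (hm hs), finrank_euclideanSpace_fin, smul_eq_mul]
  congr 2
  ext y
  simp only [Set.mem_smul, Set.mem_image, Set.mem_preimage, Set.mem_inter_iff, Set.mem_sdiff,
    mem_ball_zero_iff, Set.mem_singleton_iff, Set.mem_Ioo]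
  constructor
  · rintro ⟨r, ⟨hr0, hr1⟩, _, ⟨z, hz, rfl⟩, rfl⟩
    have hz1 : ‖(z : EuclideanSpace ℝ (Fin (k + 1)))‖ = 1 := by simp
    rw [norm_smul, Real.norm_eq_abs, abs_of_pos hr0, hz1, mul_one, smul_smul,
      div_mul_cancel₀ _ hr0.ne']
    refine ⟨hz, hr1, smul_ne_zero hr0.ne' ?_⟩
    rw [← norm_ne_zero_iff, hz1]
    exact one_ne_zero
  · rintro ⟨hys, hy1, hy0⟩
    have hn : ‖y‖ ≠ 0 := norm_ne_zero_iff.mpr hy0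
    refine ⟨‖y‖, ⟨norm_pos_iff.mpr hy0, hy1⟩, ‖y‖⁻¹ • y, ⟨⟨‖y‖⁻¹ • y, ?_⟩, ?_, rfl⟩, ?_⟩
    · simp [norm_smul, hn]
    · rwa [smul_smul, ← div_eq_mul_inv]
    · rw [smul_smul, mul_inv_cancel₀ hn, one_smul]

instance isFiniteMeasure_sphereSurface (R : ℝ) : IsFiniteMeasure (sphereSurface k R) := by
  unfold sphereSurface
  exact Measure.smul_finite _ ENNReal.ofReal_ne_top

theorem ae_norm_eq_sphereSurface {R : ℝ} (hR : 0 < R) : ∀ᵐ y ∂sphereSurface k R, ‖y‖ = R := by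
  have hm' : Measurable fun y : Metric.sphere (0 : EuclideanSpace ℝ (Fin (k + 1))) 1 =>
      R • (y : EuclideanSpace ℝ (Fin (k + 1))) := by fun_prop
  unfold sphereSurface
  refine Measure.ae_smul_measure ?_ _
  rw [ae_map_iff hm'.aemeasurable (measurableSet_eq_fun measurable_norm measurable_const)]
  refine Filter.Eventually.of_forall fun y => ?_
  simp [norm_smul, abs_of_pos hR]

theorem measurable_sphericalRatio (x : EuclideanSpace ℝ (Fin (k + 1))) :
    Measurable (sphericalRatio x) := by
  unfold sphericalRatio starPoint EuclideanGeometry.Sphere.secondInter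
  simp only [vsub_eq_sub, vadd_eq_add, sub_zero]
  fun_prop

theorem sphericalRatio_radial_eq_abs_signedRatio {R : ℝ} (hR : 0 < R)
    {x y : EuclideanSpace ℝ (Fin (k + 1))} (hx : ‖x‖ ≠ R) (hy : y ≠ 0) :
    sphericalRatio x ((R / ‖y‖) • y) = |signedRatio (R⁻¹ • x) y| := by
  have hn : ‖y‖ ≠ 0 := norm_ne_zero_iff.mpr hy
  have hRy : ‖(R / ‖y‖) • y‖ = R := by
    rw [norm_smul, Real.norm_eq_abs, abs_of_pos (by positivity), div_mul_cancel₀ _ hn]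
  have hne : x ≠ (R / ‖y‖) • y := fun h => hx (h ▸ hRy)
  have hsub : x - (R / ‖y‖) • y = (-(R / ‖y‖)) • (y - ‖y‖ • R⁻¹ • x) := by
    match_scalars <;> field_simp
  rw [sphericalRatio_eq_abs hne, signedRatio, hRy, hsub, norm_smul, norm_smul, mul_pow, mul_pow]
  simp only [Real.norm_eq_abs, sq_abs]
  congr 1
  generalize ‖y - ‖y‖ • R⁻¹ • x‖ = N
  field_simp

theorem integral_sphericalRatio_rpow_mul_odd_eq_zero {R : ℝ} (hR : 0 < R)
    {x : EuclideanSpace ℝ (Fin (k + 1))} (hx : ‖x‖ ≠ R) {h : ℝ → ℝ} (hm : Measurable h)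
    (hodd : ∀ t, h (-t) = -h t) :
    ∫ y, sphericalRatio x y ^ ((k : ℝ) / 2) * h (Real.log (sphericalRatio x y))
      ∂sphereSurface k R = 0 := by
  have hx' : ‖R⁻¹ • x‖ ≠ 1 := by
    rw [norm_smul, Real.norm_eq_abs, abs_of_pos (inv_pos.mpr hR)]
    intro h1
    apply hx
    field_simp at h1
    exact h1
  have hω := measurable_sphericalRatio x
  rw [sphereSurface_eq_map_restrict_ball k R, integral_smul_measure, integral_smul_measure,
    integral_map (by fun_prop) (by fun_prop)]
  rw [setIntegral_congr_fun (g := fun y => |signedRatio (R⁻¹ • x) y| ^ ((k : ℝ) / 2)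
      * h (Real.log |signedRatio (R⁻¹ • x) y|))
    (Metric.isOpen_ball.measurableSet.diff (measurableSet_singleton 0)),
    setIntegral_abs_signedRatio_rpow_mul_odd_eq_zero finrank_euclideanSpace_fin hx' hodd,
    smul_zero, smul_zero]
  intro y hy
  simp only [sphericalRatio_radial_eq_abs_signedRatio hR hx hy.2]

theorem exists_sphericalRatio_bounds {R : ℝ} (hR : 0 < R)
    {x : EuclideanSpace ℝ (Fin (k + 1))} (hx : ‖x‖ ≠ R) :
    ∃ C : ℝ, ∀ᵐ y ∂sphereSurface k R,
      0 < sphericalRatio x y ∧ |Real.log (sphericalRatio x y)| ≤ C := by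
  set c := |‖x‖ ^ 2 - R ^ 2| with hc
  have hd : 0 < |‖x‖ - R| := abs_pos.mpr (sub_ne_zero.mpr hx)
  have hsum : 0 < ‖x‖ + R := by positivity
  have hcpos : 0 < c := by
    rw [hc, sq_sub_sq, abs_mul]
    exact mul_pos (abs_pos.mpr hsum.ne') hd
  -- The extreme values of |x - y| on the sphere are controlled by |‖x‖ - R| and ‖x‖ + R; the sum of
  -- absolute values dominates both logarithmic bounds.
  refine ⟨|Real.log (c / (‖x‖ + R) ^ 2)| + |Real.log (c / |‖x‖ - R| ^ 2)|, ?_⟩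
  filter_upwards [ae_norm_eq_sphereSurface hR] with y hy
  have hne : x ≠ y := fun h => hx (h ▸ hy)
  have h1 : |‖x‖ - R| ≤ ‖x - y‖ := hy ▸ abs_norm_sub_norm_le x y
  have h2 : ‖x - y‖ ≤ ‖x‖ + R := hy ▸ norm_sub_le x y
  have hpos : 0 < ‖x - y‖ := hd.trans_le h1
  rw [sphericalRatio_eq_abs hne, hy, abs_div, ← hc, abs_of_pos (pow_pos hpos 2)]
  refine ⟨by positivity, ?_⟩
  have h3 : Real.log (c / (‖x‖ + R) ^ 2) ≤ Real.log (c / ‖x - y‖ ^ 2) :=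
    Real.log_le_log (by positivity) (by gcongr)
  have h4 : Real.log (c / ‖x - y‖ ^ 2) ≤ Real.log (c / |‖x‖ - R| ^ 2) :=
    Real.log_le_log (by positivity) (by gcongr)
  rw [abs_le]
  constructor
  · linarith [neg_abs_le (Real.log (c / (‖x‖ + R) ^ 2)), abs_nonneg (Real.log (c / |‖x‖ - R| ^ 2))]
  · linarith [le_abs_self (Real.log (c / |‖x‖ - R| ^ 2)), abs_nonneg (Real.log (c / (‖x‖ + R) ^ 2))]

end SphereSurface

/-! ### Integrability, the power integral and its Taylor series -/

section SphericalRatioIntegrals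

theorem integrable_continuous_comp_of_ae_abs_le {Ω F : Type*} [MeasurableSpace Ω]
    {μ : Measure Ω} [IsFiniteMeasure μ] [NormedAddCommGroup F] {X : Ω → ℝ} (hX : Measurable X)
    {C : ℝ} (hC : ∀ᵐ ω ∂μ, |X ω| ≤ C) {h : ℝ → F} (hh : Continuous h) :
    Integrable (fun ω => h (X ω)) μ := by
  obtain ⟨B, hB⟩ := (isCompact_Icc (a := -C) (b := C)).exists_bound_of_continuousOn hh.continuousOn
  refine Integrable.of_bound
    (hh.stronglyMeasurable.comp_measurable hX).aestronglyMeasurable B ?_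
  filter_upwards [hC] with ω hω using hB _ (abs_le.mp hω)

variable {k : ℕ} {R : ℝ} {x : EuclideanSpace ℝ (Fin (k + 1))}

theorem integrable_continuous_log_sphericalRatio {F : Type*} [NormedAddCommGroup F] (hR : 0 < R)
    (hx : ‖x‖ ≠ R) {h : ℝ → F} (hh : Continuous h) :
    Integrable (fun y => h (Real.log (sphericalRatio x y))) (sphereSurface k R) := by
  obtain ⟨C, hC⟩ := exists_sphericalRatio_bounds hR hx
  exact integrable_continuous_comp_of_ae_abs_le
    (Real.measurable_log.comp (measurable_sphericalRatio x)) (hC.mono fun _ h => h.2) hh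

theorem integrable_sphericalRatio_rpow_mul (hR : 0 < R) (hx : ‖x‖ ≠ R) (s : ℝ) {h : ℝ → ℝ}
    (hh : Continuous h) :
    Integrable (fun y => sphericalRatio x y ^ s * h (Real.log (sphericalRatio x y)))
      (sphereSurface k R) := by
  obtain ⟨C, hC⟩ := exists_sphericalRatio_bounds hR hx
  -- The power ω^s is absorbed as exp(s ln ω), leaving a continuous function of ln ω.
  refine (integrable_continuous_log_sphericalRatio hR hx
    (h := fun t => Real.exp (t * s) * h t) (by fun_prop)).congr ?_
  filter_upwards [hC] with y hy
  rw [Real.rpow_def_of_pos hy.1]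

theorem sphericalRatio_cpow_ae_eq (hR : 0 < R) (hx : ‖x‖ ≠ R) (α : ℂ) :
    (fun y => (sphericalRatio x y : ℂ) ^ α) =ᵐ[sphereSurface k R]
      fun y => Complex.exp (α * (Real.log (sphericalRatio x y) : ℝ)) := by
  obtain ⟨C, hC⟩ := exists_sphericalRatio_bounds hR hx
  filter_upwards [hC] with y hy
  rw [Complex.cpow_def_of_ne_zero (by exact_mod_cast hy.1.ne'), ← Complex.ofReal_log hy.1.le,
    mul_comm]

theorem integrable_sphericalRatio_cpow (hR : 0 < R) (hx : ‖x‖ ≠ R) (α : ℂ) :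
    Integrable (fun y => (sphericalRatio x y : ℂ) ^ α) (sphereSurface k R) :=
  (integrable_continuous_log_sphericalRatio hR hx
    (h := fun t : ℝ => Complex.exp (α * t)) (by fun_prop)).congr
    (sphericalRatio_cpow_ae_eq hR hx α).symm

theorem ratioIntegral_eq_complexMGF (hR : 0 < R) (hx : ‖x‖ ≠ R) :
    ratioIntegral R x = ProbabilityTheory.complexMGF
      (fun y => Real.log (sphericalRatio x y)) (sphereSurface k R) := by
  ext α
  exact integral_congr_ae (sphericalRatio_cpow_ae_eq hR hx α)

theorem integrableExpSet_log_sphericalRatio (hR : 0 < R) (hx : ‖x‖ ≠ R) :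
    ProbabilityTheory.integrableExpSet
      (fun y => Real.log (sphericalRatio x y)) (sphereSurface k R) = Set.univ :=
  Set.eq_univ_of_forall fun t => integrable_continuous_log_sphericalRatio hR hx
    (h := fun s : ℝ => Real.exp (t * s)) (by fun_prop)

theorem differentiable_ratioIntegral (hR : 0 < R) (hx : ‖x‖ ≠ R) :
    Differentiable ℂ (ratioIntegral R x) := by
  rw [ratioIntegral_eq_complexMGF hR hx]
  exact fun z => (ProbabilityTheory.hasDerivAt_complexMGF
    (by simp [integrableExpSet_log_sphericalRatio hR hx])).differentiableAt

theorem iteratedDeriv_ratioIntegral (hR : 0 < R) (hx : ‖x‖ ≠ R) (n : ℕ) :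
    iteratedDeriv n (ratioIntegral R x) ((k : ℂ) / 2) =
      ((∫ y, sphericalRatio x y ^ ((k : ℝ) / 2) * Real.log (sphericalRatio x y) ^ n
        ∂sphereSurface k R : ℝ) : ℂ) := by
  obtain ⟨C, hC⟩ := exists_sphericalRatio_bounds hR hx
  rw [ratioIntegral_eq_complexMGF hR hx, ProbabilityTheory.iteratedDeriv_complexMGF
    (by simp [integrableExpSet_log_sphericalRatio hR hx]), ← integral_complex_ofReal]
  refine integral_congr_ae ?_
  filter_upwards [hC] with y hy
  rw [Real.rpow_def_of_pos hy.1]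
  push_cast
  rw [mul_comm, mul_comm ((k : ℂ) / 2)]

theorem integral_sphericalRatio_rpow_mul_log_odd_pow_mul_cos (hR : 0 < R) (hx : ‖x‖ ≠ R) (b : ℝ)
    (m : ℕ) :
    ∫ y, sphericalRatio x y ^ ((k : ℝ) / 2) * Real.log (sphericalRatio x y) ^ (2 * m + 1)
      * Real.cos (b * Real.log (sphericalRatio x y)) ∂sphereSurface k R = 0 := by
  simp only [mul_assoc]
  refine integral_sphericalRatio_rpow_mul_odd_eq_zero hR hx
    (h := fun t => t ^ (2 * m + 1) * Real.cos (b * t)) (by fun_prop) fun t => ?_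
  rw [(odd_two_mul_add_one m).neg_pow, mul_neg, Real.cos_neg, neg_mul]

theorem integral_sphericalRatio_rpow_mul_log_even_pow_mul_sin (hR : 0 < R) (hx : ‖x‖ ≠ R) (b : ℝ)
    (m : ℕ) :
    ∫ y, sphericalRatio x y ^ ((k : ℝ) / 2) * Real.log (sphericalRatio x y) ^ (2 * m)
      * Real.sin (b * Real.log (sphericalRatio x y)) ∂sphereSurface k R = 0 := by
  simp only [mul_assoc]
  refine integral_sphericalRatio_rpow_mul_odd_eq_zero hR hx
    (h := fun t => t ^ (2 * m) * Real.sin (b * t)) (by fun_prop) fun t => ?_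
  rw [(even_two_mul m).neg_pow, mul_neg, Real.sin_neg, mul_neg]

theorem iteratedDeriv_odd_ratioIntegral (hR : 0 < R) (hx : ‖x‖ ≠ R) (m : ℕ) :
    iteratedDeriv (2 * m + 1) (ratioIntegral R x) ((k : ℂ) / 2) = 0 := by
  -- With b = 0 the cosine is 1, leaving the odd moment.
  have h := integral_sphericalRatio_rpow_mul_log_odd_pow_mul_cos hR hx 0 m
  simp only [zero_mul, Real.cos_zero, mul_one] at h
  rw [iteratedDeriv_ratioIntegral hR hx, h, Complex.ofReal_zero]

theorem integral_sphericalRatio_cpow_critical_line (hR : 0 < R) (hx : ‖x‖ ≠ R) (b : ℝ) :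
    ∫ y, (sphericalRatio x y : ℂ) ^ ((k : ℂ) / 2 + b * Complex.I) ∂(sphereSurface k R) =
      ((∫ y, sphericalRatio x y ^ ((k : ℝ) / 2)
        * Real.cos (b * Real.log (sphericalRatio x y)) ∂(sphereSurface k R) : ℝ) : ℂ) := by
  obtain ⟨C, hC⟩ := exists_sphericalRatio_bounds hR hx
  have hcos := integrable_sphericalRatio_rpow_mul hR hx ((k : ℝ) / 2)
    (h := fun t => Real.cos (b * t)) (by fun_prop)
  have hsin := integrable_sphericalRatio_rpow_mul hR hx ((k : ℝ) / 2)
    (h := fun t => Real.sin (b * t)) (by fun_prop)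
  -- The case m = 0 kills the imaginary part of ω^{k/2 + ib}.
  have h0 := integral_sphericalRatio_rpow_mul_log_even_pow_mul_sin hR hx b 0
  simp only [mul_zero, pow_zero, mul_one] at h0
  have hsplit : (fun y => (sphericalRatio x y : ℂ) ^ ((k : ℂ) / 2 + b * Complex.I))
      =ᵐ[sphereSurface k R] fun y =>
        ((sphericalRatio x y ^ ((k : ℝ) / 2)
          * Real.cos (b * Real.log (sphericalRatio x y)) : ℝ) : ℂ)
        + ((sphericalRatio x y ^ ((k : ℝ) / 2)
          * Real.sin (b * Real.log (sphericalRatio x y)) : ℝ) : ℂ) * Complex.I := by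
    filter_upwards [hC, sphericalRatio_cpow_ae_eq hR hx ((k : ℂ) / 2 + b * Complex.I)] with y hy h
    rw [h, Real.rpow_def_of_pos hy.1, add_mul, Complex.exp_add, mul_right_comm,
      ← Complex.ofReal_mul, Complex.exp_mul_I]
    push_cast
    rw [mul_comm ((k : ℂ) / 2)]
    ring
  rw [integral_congr_ae hsplit, integral_add hcos.ofReal (hsin.ofReal.mul_const _),
    integral_mul_const, integral_complex_ofReal, integral_complex_ofReal, h0]
  simp

theorem hasSum_ratioIntegral (hR : 0 < R) (hx : ‖x‖ ≠ R) (α : ℂ) :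
    HasSum (fun m : ℕ => (α - (k : ℂ) / 2) ^ (2 * m) / ((2 * m).factorial : ℂ)
      * ((∫ y, sphericalRatio x y ^ ((k : ℝ) / 2)
        * Real.log (sphericalRatio x y) ^ (2 * m) ∂(sphereSurface k R) : ℝ) : ℂ))
      (ratioIntegral R x α) := by
  have h := Complex.hasSum_taylorSeries_of_entire (differentiable_ratioIntegral hR hx)
    ((k : ℂ) / 2) α
  have hinj : Function.Injective fun m : ℕ => 2 * m := mul_right_injective₀ two_ne_zero
  -- The Taylor series may be summed over even indices only, as the odd terms vanish.
  rw [← hinj.hasSum_iff] at h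
  · refine h.congr_fun fun m => ?_
    rw [Function.comp_apply, iteratedDeriv_ratioIntegral hR hx, smul_eq_mul, smul_eq_mul,
      ← mul_assoc, div_eq_inv_mul]
  · intro n hn
    obtain ⟨m, rfl | rfl⟩ := n.even_or_odd'
    · exact absurd ⟨m, rfl⟩ hn
    · rw [iteratedDeriv_odd_ratioIntegral hR hx, smul_zero, smul_zero]

end SphericalRatioIntegrals

theorem mainTheorem2 (k : ℕ) (R : ℝ) (hR : 0 < R)
    (x : EuclideanSpace ℝ (Fin (k + 1))) (hx : ‖x‖ ≠ R) :
    -- the integral of a power with exponent on the line of symmetry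
    (∀ b : ℝ,
      Integrable (fun y => (sphericalRatio x y : ℂ) ^ ((k : ℂ) / 2 + b * Complex.I))
        (sphereSurface k R) ∧
      Integrable (fun y => sphericalRatio x y ^ ((k : ℝ) / 2)
        * Real.cos (b * Real.log (sphericalRatio x y))) (sphereSurface k R) ∧
      ∫ y, (sphericalRatio x y : ℂ) ^ ((k : ℂ) / 2 + b * Complex.I) ∂(sphereSurface k R) =
        ((∫ y, sphericalRatio x y ^ ((k : ℝ) / 2)
          * Real.cos (b * Real.log (sphericalRatio x y)) ∂(sphereSurface k R) : ℝ) : ℂ)) ∧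
    -- the vanishing logarithmic integrals
    (∀ (b : ℝ) (m : ℕ),
      (Integrable (fun y => sphericalRatio x y ^ ((k : ℝ) / 2)
        * Real.log (sphericalRatio x y) ^ (2 * m + 1)
        * Real.cos (b * Real.log (sphericalRatio x y))) (sphereSurface k R) ∧
      ∫ y, sphericalRatio x y ^ ((k : ℝ) / 2)
        * Real.log (sphericalRatio x y) ^ (2 * m + 1)
        * Real.cos (b * Real.log (sphericalRatio x y)) ∂(sphereSurface k R) = 0) ∧
      (Integrable (fun y => sphericalRatio x y ^ ((k : ℝ) / 2)
        * Real.log (sphericalRatio x y) ^ (2 * m)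
        * Real.sin (b * Real.log (sphericalRatio x y))) (sphereSurface k R) ∧
      ∫ y, sphericalRatio x y ^ ((k : ℝ) / 2)
        * Real.log (sphericalRatio x y) ^ (2 * m)
        * Real.sin (b * Real.log (sphericalRatio x y)) ∂(sphereSurface k R) = 0)) ∧
    -- `F` is defined by convergent integrals and is entire
    (∀ α : ℂ, Integrable (fun y => (sphericalRatio x y : ℂ) ^ α) (sphereSurface k R)) ∧
    Differentiable ℂ (ratioIntegral R x) ∧
    -- its Taylor coefficients at `k / 2`
    (∀ m : ℕ,
      Integrable (fun y => sphericalRatio x y ^ ((k : ℝ) / 2)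
        * Real.log (sphericalRatio x y) ^ (2 * m)) (sphereSurface k R) ∧
      iteratedDeriv (2 * m) (ratioIntegral R x) ((k : ℂ) / 2) =
        ((∫ y, sphericalRatio x y ^ ((k : ℝ) / 2)
          * Real.log (sphericalRatio x y) ^ (2 * m) ∂(sphereSurface k R) : ℝ) : ℂ) ∧
      iteratedDeriv (2 * m + 1) (ratioIntegral R x) ((k : ℂ) / 2) = 0) ∧
    -- and its Taylor decomposition on the whole plane
    (∀ α : ℂ,
      HasSum (fun m : ℕ => (α - (k : ℂ) / 2) ^ (2 * m) / ((2 * m).factorial : ℂ)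
        * ((∫ y, sphericalRatio x y ^ ((k : ℝ) / 2)
          * Real.log (sphericalRatio x y) ^ (2 * m) ∂(sphereSurface k R) : ℝ) : ℂ))
        (ratioIntegral R x α)) := by
  refine ⟨fun b => ⟨integrable_sphericalRatio_cpow hR hx _,
      integrable_sphericalRatio_rpow_mul hR hx _ (h := fun t => Real.cos (b * t)) (by fun_prop),
      integral_sphericalRatio_cpow_critical_line hR hx b⟩,
    fun b m => ⟨⟨?_, integral_sphericalRatio_rpow_mul_log_odd_pow_mul_cos hR hx b m⟩,
      ?_, integral_sphericalRatio_rpow_mul_log_even_pow_mul_sin hR hx b m⟩,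
    integrable_sphericalRatio_cpow hR hx, differentiable_ratioIntegral hR hx,
    fun m => ⟨integrable_sphericalRatio_rpow_mul hR hx _ (h := fun t => t ^ (2 * m)) (by fun_prop),
      iteratedDeriv_ratioIntegral hR hx _, iteratedDeriv_odd_ratioIntegral hR hx m⟩,
    hasSum_ratioIntegral hR hx⟩
  · simp only [mul_assoc]
    exact integrable_sphericalRatio_rpow_mul hR hx _
      (h := fun t => t ^ (2 * m + 1) * Real.cos (b * t)) (by fun_prop)
  · simp only [mul_assoc]
    exact integrable_sphericalRatio_rpow_mul hR hx _
      (h := fun t => t ^ (2 * m) * Real.sin (b * t)) (by fun_prop)
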